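/- **Proposition (Divergence degree).** Let $d\ge 3$, let $G_D=U(1)^D$ or $G_D=SU(2)^D$ with $D\ge 1$ (so $\dim G_D=D$, respectively $3D$), and let $0<a\le 1$. Consider the rank $d$ complex tensor models over $G_D$ whose kinetic term has momentum power $2a$. Their Feynman graphs $\mathcal G$ have vertices that are connected trace invariants, i.e. finite connected bipartite graphs (white vertices: fields, black vertices: conjugate fields) in which every vertex has exactly one line of each colour $1,\dots,d$, and internal lines, each joining a field to a conjugate field; the unused half-lines are the external legs. The colour extension $\mathcal G_{\rm color}$ gives the internal lines of $\mathcal G$ the colour $0$ and expands the vertices into their coloured graphs. A face of $\mathcal G$ is a connected component of the subgraph of $\mathcal G_{\rm color}$ with colours $0$ and $i$, for some $i\in\{1,\dots,d\}$; it is open if it contains an external leg and internal otherwise. The boundary graph $\partial\mathcal G$ has the external legs as vertices and the open faces as lines, with colours $1,\dots,d$. A jacket of a coloured graph is a cyclic order of all its colours, up to orientation; it defines a ribbon graph with the vertices and lines of the graph, whose faces carry two neighbouring colours of the cyclic order. A jacket is pinched (closed) by inserting a vertex at the end of each external leg. The genus $g$ of a closed ribbon graph with $C$ connected components and Euler characteristic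 $\chi$ is given by $2C-2g=\chi$, and the degree $\omega$ of a coloured graph is the sum of the genera of all its pinched jackets. A trace invariant is melonic if its degree is $0$. Let $\mathcal G$ be a connected graph (with at least one vertex) all of whose vertices are melonic, with $L$ internal lines, $F_{\rm int}$ internal faces, $N_{\rm ext}$ external legs and $V_k$ vertices of valence $k$, and let $C_{\partial\mathcal G}$ be the number of connected components of $\partial\mathcal G$. Then the divergence degree $\omega_d(\mathcal G)=-2aL+\dim G_D\,F_{\rm int}$ equals $$\omega_d(\mathcal G)=-\frac{2\dim G_D}{(d-1)!}\big(\omega(\mathcal G_{\rm color})-\omega(\partial\mathcal G)\big)-\dim G_D\,(C_{\partial\mathcal G}-1)-\frac12\Big[(\dim G_D(d-1)-2a)N_{\rm ext}-2\dim G_D(d-1)\Big]-\frac12\sum_k\Big[2\dim G_D(d-1)+(2a-\dim G_D(d-1))k\Big]V_k .$$ -/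

import Mathlib

universe u

/-- Combinatorial data of a graph whose lines carry colours in `C`: vertices, lines, the colour of
each line, and the incidence of lines with vertices.  A half-line of colour `c` at a vertex that
does not belong to a line is an external leg.  The graphs used below (trace invariants, colour
extensions, boundary graphs) are all constructed explicitly as data of this kind. -/
structure ColoredGraph (C : Type) where
  V : Type u
  Line : Type u
  color : Line → C
  inc : Line → V → Prop

namespace ColoredGraph

variable {C : Type}

/-- `u` and `v` are both ends of one line of colour `c`. -/
def Joined (H : ColoredGraph.{u} C) (c : C) (u v : H.V) : Prop :=
  ∃ l : H.Line, H.color l = c ∧ H.inc l u ∧ H.inc l v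

/-- The half-line of colour `c` at `v` is an external leg: no line of colour `c` is hooked to it. -/
def IsExternal (H : ColoredGraph.{u} C) (v : H.V) (c : C) : Prop :=
  ∀ l : H.Line, H.color l = c → ¬ H.inc l v

/-- The graph obtained by keeping only the lines with colour in `S`. -/
def colorGraph (H : ColoredGraph.{u} C) (S : Set C) : SimpleGraph H.V :=
  SimpleGraph.fromRel fun u v => ∃ c ∈ S, H.Joined c u v

/-- The maximal connected pieces made of the colours in `S` (the `p`-bubbles with `p = |S|`). -/
abbrev Piece (H : ColoredGraph.{u} C) (S : Set C) : Type u :=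
  (H.colorGraph S).ConnectedComponent

/-- A face is a bubble with two colours. -/
abbrev Face (H : ColoredGraph.{u} C) (c c' : C) : Type u := H.Piece {c, c'}

/-- A bubble is open if one of its half-lines is an external leg. -/
def PieceOpen (H : ColoredGraph.{u} C) {S : Set C} (f : H.Piece S) : Prop :=
  ∃ v : H.V, (H.colorGraph S).connectedComponentMk v = f ∧ ∃ c ∈ S, H.IsExternal v c

/-- The number of connected components of the graph. -/
noncomputable def numComponents (H : ColoredGraph.{u} C) : ℕ := Nat.card (H.Piece Set.univ)

/-- The number of external legs of the graph. -/
noncomputable def numExternal (H : ColoredGraph.{u} C) : ℕ :=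
  Nat.card {p : H.V × C // H.IsExternal p.1 p.2}

/-- The corners of a jacket `J` (a set of pairs of colours) and how the boundary of the ribbon graph
runs through them after pinching.  A corner `(v, {c, c'})` is the strand at the vertex `v` going from
the half-line `c` to the half-line `c'`.  Following the half-line `c`, it continues at the other end
of the line of colour `c`, in the corner with the same pair of colours; if the half-line `c` is an
external leg, it turns around the vertex inserted at the end of that leg and comes back at `v`, in
the other corner of `J` having `c` as a side. -/
def cornerGraph (H : ColoredGraph.{u} C) (J : Finset (Sym2 C)) :
    SimpleGraph (H.V × {P : Sym2 C // P ∈ J}) :=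
  SimpleGraph.fromRel fun x y =>
    (x.2 = y.2 ∧ ∃ c : C, c ∈ x.2.1 ∧ H.Joined c x.1 y.1) ∨
    (x.1 = y.1 ∧ ∃ c : C, c ∈ x.2.1 ∧ c ∈ y.2.1 ∧ H.IsExternal x.1 c)

/-- The number of faces of the pinched jacket. -/
noncomputable def pinchedFaces (H : ColoredGraph.{u} C) (J : Finset (Sym2 C)) : ℕ :=
  Nat.card (H.cornerGraph J).ConnectedComponent

/-- The Euler characteristic of the pinched jacket: it has all the vertices and lines of the graph,
and pinching inserts one vertex at the end of each external leg, which becomes an edge. -/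
noncomputable def pinchedEuler (H : ColoredGraph.{u} C) (J : Finset (Sym2 C)) : ℝ :=
  ((Nat.card H.V : ℝ) + H.numExternal) - ((Nat.card H.Line : ℝ) + H.numExternal) + H.pinchedFaces J

/-- The genus of the pinched jacket, given by `2 C - 2 g = χ`, with `C` the number of connected
components; thus the genus of a disconnected ribbon graph is the sum of those of its components.
For a closed graph pinching does nothing and this is the genus of the jacket. -/
noncomputable def jacketGenus (H : ColoredGraph.{u} C) (J : Finset (Sym2 C)) : ℝ :=
  (H.numComponents : ℝ) - H.pinchedEuler J / 2

end ColoredGraph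

open Classical in
/-- The jackets of a graph with colour set `C`: the cyclic orders of all the colours, up to
orientation.  A cyclic order `σ` up to orientation is recorded by its set of pairs `{c, σ c}` of
neighbouring colours. -/
noncomputable def jackets (C : Type) [Fintype C] : Finset (Finset (Sym2 C)) :=
  ((Finset.univ : Finset (Equiv.Perm C)).filter
    fun σ => σ.IsCycle ∧ σ.support = Finset.univ).image
      fun σ => Finset.univ.image fun c => s(c, σ c)

/-- The degree: the sum of the genera of all (pinched) jackets. -/
noncomputable def ColoredGraph.degree {C : Type} [Fintype C] (H : ColoredGraph.{u} C) : ℝ :=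
  ∑ J ∈ jackets C, H.jacketGenus J

/-- A closed bipartite graph, with white and black vertices, whose lines have `d` colours, each
vertex being an end of exactly one line of each colour: the line of colour `i` at the white vertex
`w` ends at the black vertex `edge i w`. -/
structure ClosedBipartite (d : ℕ) where
  White : Type u
  Black : Type u
  [finW : Finite White]
  [finB : Finite Black]
  edge : Fin d → White ≃ Black

attribute [instance] ClosedBipartite.finW ClosedBipartite.finB

/-- The underlying coloured graph, with lines `(w, i)`, `w` a white vertex and `i` a colour. -/
def ClosedBipartite.toColored {d : ℕ} (b : ClosedBipartite.{u} d) : ColoredGraph.{u} (Fin d) where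
  V := b.White ⊕ b.Black
  Line := b.White × Fin d
  color l := l.2
  inc l v := v = Sum.inl l.1 ∨ v = Sum.inr (b.edge l.2 l.1)

/-- A connected trace invariant of rank `d` tensors: a connected closed bipartite `d`-coloured graph
whose white and black vertices are the fields `φ` and the conjugate fields. -/
structure TraceInvariant (d : ℕ) extends ClosedBipartite.{u} d where
  connected : (toClosedBipartite.toColored.colorGraph Set.univ).Connected

namespace TraceInvariant

variable {d : ℕ}

/-- The number of fields, that is the valence of the interaction vertex. -/
noncomputable def valence (b : TraceInvariant.{u} d) : ℕ := Nat.card b.White + Nat.card b.Black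

/-- A trace invariant is melonic if its degree vanishes. -/
def IsMelonic (b : TraceInvariant.{u} d) : Prop := b.toColored.degree = 0

end TraceInvariant

/-- A Feynman graph of a rank `d` complex tensor model (an uncoloured tensor graph): finitely many
vertices, each a connected trace invariant, and lines (propagators), each joining a field to a
conjugate field; each half-line is used at most once, and the unused ones are the external legs. -/
structure TensorGraph (d : ℕ) where
  Vertex : Type u
  [finV : Finite Vertex]
  vertex : Vertex → TraceInvariant.{u} d
  line : (Σ v, (vertex v).White) ≃. (Σ v, (vertex v).Black)

attribute [instance] TensorGraph.finV

namespace TensorGraph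

variable {d : ℕ}

/-- The half-lines hooked to the vertices that carry a field. -/
abbrev White (G : TensorGraph.{u} d) : Type u := Σ v, (G.vertex v).White

/-- The half-lines hooked to the vertices that carry a conjugate field. -/
abbrev Black (G : TensorGraph.{u} d) : Type u := Σ v, (G.vertex v).Black

/-- The internal lines, each labelled by its white half-line. -/
abbrev Line (G : TensorGraph.{u} d) : Type u := {w : G.White // (G.line w).isSome}

/-- The graph is connected (in particular it has at least one vertex). -/
def Connected (G : TensorGraph.{u} d) : Prop :=
  (SimpleGraph.fromRel fun u v : G.Vertex =>
    ∃ (x : (G.vertex u).White) (y : (G.vertex v).Black), G.line ⟨u, x⟩ = some ⟨v, y⟩).Connected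

/-- The colour extension, with colours `0, …, d`: the lines have colour `0`, and the vertices are
expanded into the coloured graphs that define them, with the colours `1, …, d`. -/
def colorExt (G : TensorGraph.{u} d) : ColoredGraph.{u} (Fin (d + 1)) where
  V := G.White ⊕ G.Black
  Line := G.Line ⊕ (G.White × Fin d)
  color := Sum.elim (fun _ => 0) (fun l => l.2.succ)
  inc
    | Sum.inl l, v => v = Sum.inl l.1 ∨ ∃ y, G.line l.1 = some y ∧ v = Sum.inr y
    | Sum.inr (w, i), v => v = Sum.inl w ∨ v = Sum.inr ⟨w.1, (G.vertex w.1).edge i w.2⟩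

/-- The faces `(0 i)`: the connected components of the `i`-th strand. -/
abbrev StrandFace (G : TensorGraph.{u} d) (i : Fin d) : Type u := G.colorExt.Face 0 i.succ

/-- The boundary graph: its vertices are the external legs (a leg is recorded by the vertex of the
colour extension that carries it), its lines of colour `i` are the open faces `(0 i)`, and a leg is
an end of the open faces that pass through it. -/
def boundary (G : TensorGraph.{u} d) : ColoredGraph.{u} (Fin d) where
  V := {v : G.colorExt.V // G.colorExt.IsExternal v 0}
  Line := Σ i : Fin d, {f : G.StrandFace i // G.colorExt.PieceOpen f}
  color l := l.1
  inc l v := (G.colorExt.colorGraph {0, l.1.succ}).connectedComponentMk v.1 = l.2.1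

/-- The number of internal lines. -/
noncomputable def numLines (G : TensorGraph.{u} d) : ℕ := Nat.card G.Line

/-- The number of internal (closed) faces. -/
noncomputable def numInternalFaces (G : TensorGraph.{u} d) : ℕ :=
  Nat.card (Σ i : Fin d, {f : G.StrandFace i // ¬ G.colorExt.PieceOpen f})

/-- The number of external legs. -/
noncomputable def numExt (G : TensorGraph.{u} d) : ℕ :=
  Nat.card {w : G.White // G.line w = none} + Nat.card {y : G.Black // G.line.symm y = none}

/-- The number of vertices of valence `k`. -/
noncomputable def numVertices (G : TensorGraph.{u} d) (k : ℕ) : ℕ :=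
  Nat.card {v : G.Vertex // (G.vertex v).valence = k}

/-- The finite set of the valences that occur in the graph. -/
noncomputable def valences (G : TensorGraph.{u} d) : Finset ℕ :=
  (Set.finite_range fun v : G.Vertex => (G.vertex v).valence).toFinset

end TensorGraph

/-- The two families of background groups: powers of `U(1)` and powers of `SU(2)`. -/
inductive BaseGroup
  | U1
  | SU2

/-- The dimension of the group `U(1) ^ D`, respectively `SU(2) ^ D`. -/
def dimG : BaseGroup → ℕ → ℕ
  | BaseGroup.U1, D => D
  | BaseGroup.SU2, D => 3 * D

/-- The divergence degree `- 2 a L + dim G_D * F_int` of a graph in the model over `G_D` whose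
kinetic term has the momentum power `2 a`. -/
noncomputable def TensorGraph.divergenceDegree {d : ℕ} (B : BaseGroup) (D : ℕ) (a : ℝ)
    (G : TensorGraph.{u} d) : ℝ :=
  -2 * a * G.numLines + dimG B D * G.numInternalFaces

/-! In the genus of a pinched jacket only the number of faces depends on the jacket. Summed over all
jackets, the degree is thus affine in face counts, each weighted by the number of cyclic orders in
which the colours concerned are neighbours. In a closed graph with n ≥ 3 colours each pair of
colours occurs in (n-2)! of the (n-1)!/2 jackets, so for fixed numbers of vertices, lines and
components the degree and the number of faces determine each other (`two_mul_degree_of_closed`). For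
a melonic vertex this gives the number of faces as a function of the valence; for the boundary graph
it trades faces for ω(∂G).

In the colour extension, a jacket where 0 lies between i and j has faces avoiding 0, which live
inside single vertices, internal faces (0 i) and (0 j), and closed curves made of open strands (0 i)
and (0 j) glued at the pinched legs. The latter are exactly the faces (i j) of the boundary graph
(`pinchedFaces_colorExt`). There are (d-2)! oriented cyclic orders of the d+1 colours with
prescribed predecessor and successor of 0, which is also the weight of a face in the degree of the
d-coloured boundary graph. Subtracting the two degree formulas therefore eliminates the boundary
faces and leaves an equation for the internal faces (`numInternalFaces_eq_degree`). Counting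
half-lines then rewrites lines and vertices through external legs and valences. -/

/-! ### Counting cyclic orders with prescribed neighbours. -/

section CyclicOrders

open Finset

variable {C : Type} [Fintype C]

open Classical in
/-- The permutations that consist of one cycle through all elements: the oriented cyclic orders. -/
noncomputable def fullCycles (C : Type) [Fintype C] : Finset (Equiv.Perm C) :=
  univ.filter fun σ => σ.IsCycle ∧ σ.support = univ

open Classical in
/-- The pairs of neighbours in the cyclic order `σ`. -/
noncomputable def neighbourPairs (σ : Equiv.Perm C) : Finset (Sym2 C) :=
  univ.image fun c => s(c, σ c)

theorem mem_neighbourPairs {σ : Equiv.Perm C} {P : Sym2 C} :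
    P ∈ neighbourPairs σ ↔ ∃ c, s(c, σ c) = P := by
  simp [neighbourPairs]

theorem mem_fullCycles {σ : Equiv.Perm C} :
    σ ∈ fullCycles C ↔ σ.IsCycle ∧ ∀ x, σ x ≠ x := by
  simp [fullCycles, Finset.eq_univ_iff_forall]

theorem inv_mem_fullCycles {σ : Equiv.Perm C} (h : σ ∈ fullCycles C) : σ⁻¹ ∈ fullCycles C := by
  rw [mem_fullCycles] at h ⊢
  exact ⟨h.1.inv, fun x hx => h.2 x (by rw [Equiv.Perm.inv_eq_iff_eq] at hx; exact hx.symm)⟩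

theorem conj_mem_fullCycles {σ : Equiv.Perm C} (τ : Equiv.Perm C) (h : σ ∈ fullCycles C) :
    τ * σ * τ⁻¹ ∈ fullCycles C := by
  rw [mem_fullCycles] at h ⊢
  refine ⟨h.1.conj, fun x hx => h.2 (τ⁻¹ x) ?_⟩
  rw [Equiv.Perm.mul_apply, Equiv.Perm.mul_apply] at hx
  rw [Equiv.Perm.eq_inv_iff_eq, hx]

theorem card_fullCycles (h : 2 ≤ Fintype.card C) :
    (fullCycles C).card = (Fintype.card C - 1).factorial := by
  classical
  have h1 : fullCycles C =
      univ.filter fun σ : Equiv.Perm C => σ.cycleType = {Fintype.card C} := by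
    ext σ
    simp only [fullCycles, mem_filter, mem_univ, true_and]
    constructor
    · rintro ⟨h1, h2⟩
      rw [h1.cycleType, ← Finset.card_univ, ← h2]
    · intro h1
      have h2 := Equiv.Perm.card_cycleType_eq_one.1 (by rw [h1]; simp)
      refine ⟨h2, ?_⟩
      rw [h2.cycleType, Multiset.singleton_inj] at h1
      convert! Finset.card_eq_iff_eq_univ _ |>.1 h1
  rw [h1, Equiv.Perm.card_of_cycleType]
  obtain ⟨n, hn⟩ : ∃ n, Fintype.card C = n + 1 := ⟨Fintype.card C - 1, by omega⟩
  rw [if_pos (by simpa using h)]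
  simp only [hn, Multiset.sum_singleton, Multiset.prod_singleton, Multiset.toFinset_singleton,
    prod_singleton, Multiset.count_singleton_self]
  simp [Nat.factorial_succ, Nat.mul_div_cancel_left _ (Nat.succ_pos n)]

/-- With at least three elements, no cyclic order exchanges two elements. -/
theorem apply_apply_ne (h : 3 ≤ Fintype.card C) {σ : Equiv.Perm C} (hσ : σ ∈ fullCycles C)
    (x : C) : σ (σ x) ≠ x := by
  classical
  intro hx
  rw [mem_fullCycles] at hσ
  have h1 : ∀ n : ℕ, (σ ^ n) x = x ∨ (σ ^ n) x = σ x := by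
    intro n
    induction n with
    | zero => simp
    | succ n ih =>
      rw [pow_succ', Equiv.Perm.mul_apply]
      rcases ih with ih | ih <;> rw [ih] <;> simp [hx]
  have h2 : (univ : Finset C) ⊆ {x, σ x} := by
    intro y _
    obtain ⟨n, hn⟩ := hσ.1.exists_pow_eq (hσ.2 x) (hσ.2 y)
    have := h1 n
    rw [hn] at this
    simpa using this
  have h3 := (Finset.card_le_card h2).trans Finset.card_le_two
  rw [Finset.card_univ] at h3
  omega

theorem mk_apply_injective (h : 3 ≤ Fintype.card C) {σ : Equiv.Perm C} (hσ : σ ∈ fullCycles C) :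
    Function.Injective fun c => s(c, σ c) := by
  intro c c' hc
  rcases Sym2.eq_iff.1 hc with ⟨h1, -⟩ | ⟨h1, h2⟩
  · exact h1
  · exact absurd (by rw [h2, ← h1]) (apply_apply_ne h hσ c)

theorem sum_neighbourPairs (h : 3 ≤ Fintype.card C) {σ : Equiv.Perm C} (hσ : σ ∈ fullCycles C)
    (F : Sym2 C → ℝ) : ∑ P ∈ neighbourPairs σ, F P = ∑ c, F s(c, σ c) := by
  classical
  rw [neighbourPairs, Finset.sum_image]
  exact (mk_apply_injective h hσ).injOn

theorem mk_mem_neighbourPairs {σ : Equiv.Perm C} {c c' : C} :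
    s(c, c') ∈ neighbourPairs σ ↔ c' = σ c ∨ c' = σ⁻¹ c := by
  rw [mem_neighbourPairs, Equiv.Perm.eq_inv_iff_eq]
  constructor
  · rintro ⟨x, hx⟩
    rcases Sym2.eq_iff.1 hx with ⟨rfl, rfl⟩ | ⟨rfl, rfl⟩ <;> simp
  · rintro (rfl | rfl)
    · exact ⟨c, rfl⟩
    · exact ⟨c', Sym2.eq_swap⟩

theorem neighbourPairs_inv (σ : Equiv.Perm C) : neighbourPairs σ⁻¹ = neighbourPairs σ := by
  ext P
  induction P with
  | _ c c' => rw [mk_mem_neighbourPairs, mk_mem_neighbourPairs, inv_inv, or_comm]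

/-- The pairs record the two neighbours of each colour but not the direction of travel; one common
successor fixes the direction, and this propagates along the cycle. -/
theorem eq_of_neighbourPairs_eq {σ τ : Equiv.Perm C} (hσ : σ ∈ fullCycles C)
    (hστ : neighbourPairs σ = neighbourPairs τ) {c : C} (hc : σ c = τ c) : σ = τ := by
  have step : ∀ x, σ x = τ x → σ (σ x) = τ (σ x) := by
    intro x hx
    have h1 : s(σ x, σ (σ x)) ∈ neighbourPairs τ := by
      rw [← hστ, mk_mem_neighbourPairs]; exact Or.inl rfl
    have h2 : s(σ x, τ (σ x)) ∈ neighbourPairs σ := by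
      rw [hστ, mk_mem_neighbourPairs]; exact Or.inl rfl
    rw [mk_mem_neighbourPairs] at h1 h2
    rcases h1 with h1 | h1
    · exact h1
    rcases h2 with h2 | h2
    · exact h2.symm
    -- If both successors are predecessors for the other permutation, both equal `x`.
    rw [h1, h2, Equiv.Perm.inv_eq_iff_eq.2 rfl, Equiv.Perm.inv_eq_iff_eq.2 hx]
  have h1 : ∀ n : ℕ, σ ((σ ^ n) c) = τ ((σ ^ n) c) := by
    intro n
    induction n with
    | zero => simpa using hc
    | succ n ih => rw [pow_succ', Equiv.Perm.mul_apply]; exact step _ ih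
  rw [mem_fullCycles] at hσ
  ext x
  obtain ⟨n, hn⟩ := hσ.1.exists_pow_eq (hσ.2 c) (hσ.2 x)
  rw [← hn, h1]

theorem neighbourPairs_eq_iff {σ τ : Equiv.Perm C} (hσ : σ ∈ fullCycles C) :
    neighbourPairs τ = neighbourPairs σ ↔ τ = σ ∨ τ = σ⁻¹ := by
  constructor
  · intro h
    by_contra! hne
    obtain ⟨c, -⟩ := (mem_fullCycles.1 hσ).1
    have h1 : s(c, τ c) ∈ neighbourPairs σ := by
      rw [← h, mk_mem_neighbourPairs]; exact Or.inl rfl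
    rw [mk_mem_neighbourPairs] at h1
    rcases h1 with h1 | h1
    · exact hne.1 (eq_of_neighbourPairs_eq hσ h.symm h1.symm).symm
    · exact hne.2 (eq_of_neighbourPairs_eq (inv_mem_fullCycles hσ)
        (by rw [neighbourPairs_inv, h]) h1.symm).symm
  · rintro (rfl | rfl)
    · rfl
    · exact neighbourPairs_inv σ

/-- Each jacket comes from exactly two oriented cyclic orders. -/
theorem two_mul_sum_jackets (h : 3 ≤ Fintype.card C) (f : Finset (Sym2 C) → ℝ) :
    2 * ∑ J ∈ jackets C, f J = ∑ σ ∈ fullCycles C, f (neighbourPairs σ) := by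
  classical
  have h0 : jackets C = (fullCycles C).image neighbourPairs := by
    simp only [jackets, fullCycles]
    congr!
  rw [Finset.sum_comp f neighbourPairs, ← h0, Finset.mul_sum]
  refine Finset.sum_congr rfl fun J hJ => ?_
  rw [h0, Finset.mem_image] at hJ
  obtain ⟨σ, hσ, rfl⟩ := hJ
  have h1 : ({τ ∈ fullCycles C | neighbourPairs τ = neighbourPairs σ} : Finset _) =
      {σ, σ⁻¹} := by
    ext τ
    simp only [mem_filter, neighbourPairs_eq_iff hσ, mem_insert, mem_singleton]
    refine ⟨fun h => h.2, fun h => ⟨?_, h⟩⟩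
    rcases h with rfl | rfl
    exacts [hσ, inv_mem_fullCycles hσ]
  have h2 : σ ≠ σ⁻¹ := by
    intro h2
    obtain ⟨c, -⟩ := (mem_fullCycles.1 hσ).1
    refine apply_apply_ne h hσ c ?_
    nth_rewrite 1 [h2]
    simp
  rw [h1, Finset.card_pair h2]
  simp

theorem two_mul_card_jackets (h : 3 ≤ Fintype.card C) :
    2 * ((jackets C).card : ℝ) = (Fintype.card C - 1).factorial := by
  have := two_mul_sum_jackets h fun _ => 1
  rwa [Finset.sum_const, Finset.sum_const, card_fullCycles (by omega), nsmul_eq_mul,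
    nsmul_eq_mul, mul_one, mul_one] at this

variable [DecidableEq C]

/-- Conjugation by the transposition of `y` and `y'` fixes `x` and exchanges the two sets. -/
theorem card_filter_apply_eq_congr (x y y' : C) (hy : y ≠ x) (hy' : y' ≠ x) :
    ((fullCycles C).filter fun σ => σ x = y).card =
      ((fullCycles C).filter fun σ => σ x = y').card := by
  refine Finset.card_bij' (fun σ _ => Equiv.swap y y' * σ * (Equiv.swap y y')⁻¹)
    (fun σ _ => Equiv.swap y y' * σ * (Equiv.swap y y')⁻¹) ?_ ?_ ?_ ?_
  · intro σ hσ
    rw [mem_filter] at hσ ⊢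
    refine ⟨conj_mem_fullCycles _ hσ.1, ?_⟩
    simp [Equiv.swap_apply_of_ne_of_ne hy.symm hy'.symm, hσ.2]
  · intro σ hσ
    rw [mem_filter] at hσ ⊢
    refine ⟨conj_mem_fullCycles _ hσ.1, ?_⟩
    simp [Equiv.swap_apply_of_ne_of_ne hy.symm hy'.symm, hσ.2]
  · intro σ _
    ext; simp
  · intro σ _
    ext; simp

/-- By symmetry the (n-1)! cycles split into n-1 equal classes according to the image of `x`. -/
theorem card_filter_apply_eq (h : 2 ≤ Fintype.card C) {x y : C} (hy : y ≠ x) :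
    ((fullCycles C).filter fun σ => σ x = y).card = (Fintype.card C - 2).factorial := by
  have h1 := Finset.card_eq_sum_card_fiberwise (s := fullCycles C) (t := univ.erase x)
    (f := fun σ => σ x) (fun σ hσ => by simpa using (mem_fullCycles.1 hσ).2 x)
  rw [Finset.sum_congr rfl (fun z hz => card_filter_apply_eq_congr x z y (by simpa using hz) hy),
    Finset.sum_const, Finset.card_erase_of_mem (mem_univ x), Finset.card_univ,
    card_fullCycles h] at h1
  obtain ⟨n, hn⟩ : ∃ n, Fintype.card C = n + 2 := ⟨Fintype.card C - 2, by omega⟩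
  rw [hn] at h1 ⊢
  simp only [Nat.add_sub_cancel, show n + 2 - 1 = n + 1 by omega, Nat.factorial_succ,
    smul_eq_mul] at h1 ⊢
  exact (Nat.eq_of_mul_eq_mul_left (Nat.succ_pos n) h1).symm

theorem card_filter_apply_apply_eq_congr (x y y' z : C) (hy : y ≠ x) (hy' : y' ≠ x)
    (hz : y ≠ z) (hz' : y' ≠ z) :
    ((fullCycles C).filter fun σ => σ x = z ∧ σ y = x).card =
      ((fullCycles C).filter fun σ => σ x = z ∧ σ y' = x).card := by
  refine Finset.card_bij' (fun σ _ => Equiv.swap y y' * σ * (Equiv.swap y y')⁻¹)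
    (fun σ _ => Equiv.swap y y' * σ * (Equiv.swap y y')⁻¹) ?_ ?_ ?_ ?_
  · intro σ hσ
    rw [mem_filter] at hσ ⊢
    refine ⟨conj_mem_fullCycles _ hσ.1, ?_⟩
    simp [Equiv.swap_apply_of_ne_of_ne hy.symm hy'.symm, hσ.2,
      Equiv.swap_apply_of_ne_of_ne hz.symm hz'.symm]
  · intro σ hσ
    rw [mem_filter] at hσ ⊢
    refine ⟨conj_mem_fullCycles _ hσ.1, ?_⟩
    simp [Equiv.swap_apply_of_ne_of_ne hy.symm hy'.symm, hσ.2,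
      Equiv.swap_apply_of_ne_of_ne hz.symm hz'.symm]
  · intro σ _
    ext; simp
  · intro σ _
    ext; simp

/-- The (n-2)! cycles with a fixed successor of `x` split into n-2 equal classes according to the
predecessor of `x`. -/
theorem card_filter_apply_apply_eq (h : 3 ≤ Fintype.card C) {x y z : C} (hy : y ≠ x) (hz : z ≠ x)
    (hyz : y ≠ z) :
    ((fullCycles C).filter fun σ => σ x = z ∧ σ y = x).card =
      (Fintype.card C - 3).factorial := by
  have h1 := Finset.card_eq_sum_card_fiberwise (s := (fullCycles C).filter fun σ => σ x = z)
    (t := (univ.erase x).erase z)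
    (f := fun σ => σ⁻¹ x) (fun σ hσ => by
      simp only [coe_filter, Set.mem_ofPred_eq] at hσ
      simp only [coe_erase, coe_univ, Set.mem_sdiff, Set.mem_univ, true_and,
        Set.mem_singleton_iff, Equiv.Perm.inv_eq_iff_eq]
      refine ⟨fun h => (mem_fullCycles.1 hσ.1).2 x h.symm, fun h' => ?_⟩
      exact apply_apply_ne h hσ.1 x (by rw [hσ.2, ← h']))
  have h2 : ∀ w ∈ (univ.erase x).erase z,
      ({σ ∈ (fullCycles C).filter fun σ => σ x = z | σ⁻¹ x = w} : Finset _).card =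
      ((fullCycles C).filter fun σ => σ x = z ∧ σ y = x).card := by
    intro w hw
    simp only [mem_erase, mem_univ, and_true] at hw
    rw [← card_filter_apply_apply_eq_congr x w y z hw.2 hy hw.1 hyz, Finset.filter_filter]
    simp only [Equiv.Perm.inv_eq_iff_eq, eq_comm (a := x)]
  rw [Finset.sum_congr rfl h2, Finset.sum_const, Finset.card_erase_of_mem (by simpa using hz),
    Finset.card_erase_of_mem (mem_univ x), Finset.card_univ,
    card_filter_apply_eq (by omega) hz] at h1
  obtain ⟨n, hn⟩ : ∃ n, Fintype.card C = n + 3 := ⟨Fintype.card C - 3, by omega⟩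
  rw [hn] at h1 ⊢
  simp only [Nat.add_sub_cancel, show n + 3 - 2 = n + 1 by omega, Nat.factorial_succ,
    smul_eq_mul, show n + 3 - 1 - 1 = n + 1 by omega] at h1 ⊢
  exact (Nat.eq_of_mul_eq_mul_left (Nat.succ_pos n) h1).symm

theorem sum_fullCycles_apply (h : 2 ≤ Fintype.card C) (x : C) (F : C → ℝ) :
    ∑ σ ∈ fullCycles C, F (σ x) =
      (Fintype.card C - 2).factorial * ∑ y, if y = x then 0 else F y := by
  rw [← Finset.sum_fiberwise (fullCycles C) (fun σ => σ x), Finset.mul_sum]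
  refine Finset.sum_congr rfl fun y _ => ?_
  rw [Finset.sum_congr rfl (g := fun _ => F y) (fun σ hσ => by rw [(mem_filter.1 hσ).2]),
    Finset.sum_const]
  split_ifs with hy
  · subst hy
    rw [Finset.filter_false_of_mem fun σ hσ => (mem_fullCycles.1 hσ).2 y]
    simp
  · rw [card_filter_apply_eq h hy, nsmul_eq_mul]

theorem sum_fullCycles_inv_apply (h : 2 ≤ Fintype.card C) (x : C) (F : C → ℝ) :
    ∑ σ ∈ fullCycles C, F (σ⁻¹ x) =
      (Fintype.card C - 2).factorial * ∑ y, if y = x then 0 else F y := by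
  rw [← sum_fullCycles_apply h x F]
  exact Finset.sum_nbij' (fun σ => σ⁻¹) (fun σ => σ⁻¹) (fun _ => inv_mem_fullCycles)
    (fun _ => inv_mem_fullCycles) (by simp) (by simp) (by simp)

theorem sum_fullCycles_inv_apply_apply (h : 3 ≤ Fintype.card C) (x : C) (F : C → C → ℝ) :
    ∑ σ ∈ fullCycles C, F (σ⁻¹ x) (σ x) =
      (Fintype.card C - 3).factorial *
        ∑ y, ∑ z, if y = x ∨ z = x ∨ y = z then 0 else F y z := by
  rw [← Finset.sum_product', ← Finset.sum_fiberwise (fullCycles C) (fun σ => (σ⁻¹ x, σ x)),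
    Finset.mul_sum, Finset.univ_product_univ]
  refine Finset.sum_congr rfl fun p _ => ?_
  obtain ⟨y, z⟩ := p
  rw [Finset.sum_congr rfl (g := fun _ => F y z) (fun σ hσ => by
    have := (mem_filter.1 hσ).2
    simp only [Prod.mk.injEq] at this
    rw [this.1, this.2]), Finset.sum_const]
  have h1 : ((fullCycles C).filter fun σ => (σ⁻¹ x, σ x) = (y, z)) =
      ((fullCycles C).filter fun σ => σ x = z ∧ σ y = x) := by
    refine Finset.filter_congr fun σ _ => ?_
    rw [Prod.mk.injEq, Equiv.Perm.inv_eq_iff_eq, and_comm, eq_comm (a := x)]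
  rw [h1]
  dsimp only
  split_ifs with hy
  · rw [Finset.filter_false_of_mem]
    · simp
    · rintro σ hσ ⟨h2, h3⟩
      have h4 := (mem_fullCycles.1 hσ).2
      rcases hy with rfl | rfl | rfl
      · exact h4 _ h3
      · exact h4 _ h2
      · exact apply_apply_ne h hσ x (by rw [h2, h3])
  · push Not at hy
    rw [card_filter_apply_apply_eq h hy.1 hy.2.1 hy.2.2, nsmul_eq_mul]

/-- The factor 2 on the left accounts for the two orientations of a jacket; on the right each
unordered pair occurs twice. -/
theorem two_mul_sum_jackets_sum (h : 3 ≤ Fintype.card C) (F : Sym2 C → ℝ) :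
    2 * ∑ J ∈ jackets C, ∑ P ∈ J, F P =
      (Fintype.card C - 2).factorial * ∑ x, ∑ y, if y = x then 0 else F s(x, y) := by
  rw [two_mul_sum_jackets h fun J => ∑ P ∈ J, F P,
    Finset.sum_congr rfl fun σ hσ => sum_neighbourPairs h hσ F, Finset.sum_comm, Finset.mul_sum]
  exact Finset.sum_congr rfl fun x _ => sum_fullCycles_apply (by omega) x fun y => F s(x, y)

end CyclicOrders

/-! ### Connected components of the graph generated by a relation. -/

namespace SimpleGraph

variable {α β : Type*} {r : α → α → Prop}

theorem connectedComponentMk_fromRel_eq {a b : α} (h : r a b) :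
    (fromRel r).connectedComponentMk a = (fromRel r).connectedComponentMk b := by
  by_cases hab : a = b
  · rw [hab]
  · exact ConnectedComponent.sound (Adj.reachable ((fromRel_adj r a b).2 ⟨hab, Or.inl h⟩))

/-- A function that is constant along `r` descends to the connected components of the graph
generated by `r`. -/
def fromRelLift (f : α → β) (hf : ∀ a b, r a b → f a = f b) :
    (fromRel r).ConnectedComponent → β :=
  ConnectedComponent.lift f fun v w p _ => by
    induction p with
    | nil => rfl
    | cons h _ ih =>
      rename_i hp
      rw [← ih hp.of_cons]
      rcases ((fromRel_adj r _ _).1 h).2 with h | h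
      · exact hf _ _ h
      · exact (hf _ _ h).symm

end SimpleGraph

/-! ### Faces of jackets, and the degree as a count of faces. -/

namespace ColoredGraph

variable {C : Type} (H : ColoredGraph.{u} C)

/-- The piece that contains a vertex. -/
abbrev pieceMk (S : Set C) (v : H.V) : H.Piece S := (H.colorGraph S).connectedComponentMk v

variable {H}

theorem pieceMk_eq {S : Set C} {c : C} (hc : c ∈ S) {u v : H.V} (h : H.Joined c u v) :
    H.pieceMk S u = H.pieceMk S v :=
  SimpleGraph.connectedComponentMk_fromRel_eq (r := fun u v => ∃ c ∈ S, H.Joined c u v) ⟨c, hc, h⟩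

/-- A function on the vertices that is constant along the lines with colour in `S` descends to the
pieces. -/
def pieceLift {β : Type*} {S : Set C} (f : H.V → β)
    (hf : ∀ c ∈ S, ∀ u v, H.Joined c u v → f u = f v) : H.Piece S → β :=
  SimpleGraph.fromRelLift f fun u v ⟨c, hc, h⟩ => hf c hc u v h

theorem pieceMk_surjective (S : Set C) : Function.Surjective (H.pieceMk S) :=
  Quot.mk_surjective

instance finite_piece [Finite H.V] (S : Set C) : Finite (H.Piece S) :=
  Finite.of_surjective _ (pieceMk_surjective S)

/-- The connected component of the boundary of the ribbon graph through a corner. -/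
abbrev cornerMk (H : ColoredGraph.{u} C) (J : Finset (Sym2 C)) (x : H.V × {P : Sym2 C // P ∈ J}) :
    (H.cornerGraph J).ConnectedComponent := (H.cornerGraph J).connectedComponentMk x

theorem cornerMk_surjective (J : Finset (Sym2 C)) : Function.Surjective (H.cornerMk J) :=
  Quot.mk_surjective

theorem cornerMk_eq_of_joined {J : Finset (Sym2 C)} (P : {P : Sym2 C // P ∈ J}) {c : C}
    (hc : c ∈ P.1) {u v : H.V} (h : H.Joined c u v) : H.cornerMk J (u, P) = H.cornerMk J (v, P) :=
  SimpleGraph.connectedComponentMk_fromRel_eq (Or.inl ⟨rfl, c, hc, h⟩)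

theorem cornerMk_eq_of_isExternal {J : Finset (Sym2 C)} (P Q : {P : Sym2 C // P ∈ J}) {c : C}
    (hP : c ∈ P.1) (hQ : c ∈ Q.1) {v : H.V} (h : H.IsExternal v c) :
    H.cornerMk J (v, P) = H.cornerMk J (v, Q) :=
  SimpleGraph.connectedComponentMk_fromRel_eq (Or.inr ⟨rfl, c, hP, hQ, h⟩)

/-- The faces of a jacket of a closed graph are the pieces with two neighbouring colours. -/
theorem pinchedFaces_of_closed [Finite H.V] (hH : ∀ v c, ¬ H.IsExternal v c)
    (J : Finset (Sym2 C)) :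
    H.pinchedFaces J = ∑ P ∈ J, Nat.card (H.Piece {c | c ∈ P}) := by
  let e : (H.cornerGraph J).ConnectedComponent ≃ Σ P : {P // P ∈ J}, H.Piece {c | c ∈ P.1} :=
    { toFun := SimpleGraph.fromRelLift (fun x => ⟨x.2, H.pieceMk _ x.1⟩) (by
        rintro ⟨v, P⟩ ⟨w, Q⟩ (⟨rfl, c, hc, h⟩ | ⟨-, c, -, -, h⟩)
        · exact congrArg _ (pieceMk_eq (S := {c | c ∈ P.1}) hc h)
        -- Without external legs no strand changes its pair of colours, so the pair is an invariant
        -- of the face.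
        · exact absurd h (hH _ _))
      invFun := fun x => pieceLift (fun v => H.cornerMk J (v, x.1))
        (fun c hc u v h => cornerMk_eq_of_joined _ hc h) x.2
      left_inv := by
        intro x
        obtain ⟨x, rfl⟩ := cornerMk_surjective J x
        rfl
      right_inv := by
        rintro ⟨P, f⟩
        obtain ⟨v, rfl⟩ := pieceMk_surjective _ f
        rfl }
  rw [pinchedFaces, Nat.card_congr e, Nat.card_sigma]
  exact Finset.sum_coe_sort J fun P => Nat.card (H.Piece {c | c ∈ P})

/-- Twice the number of faces, that is of pieces with two colours. -/
noncomputable def twiceFaces [Fintype C] [DecidableEq C] (H : ColoredGraph.{u} C) : ℝ :=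
  ∑ x, ∑ y, if y = x then 0 else (Nat.card (H.Face x y) : ℝ)

theorem setOf_mem_mk (x y : C) : {c | c ∈ s(x, y)} = ({x, y} : Set C) := by
  ext c; simp

/-- Each leg contributes one inserted vertex and one edge, which cancel in the Euler characteristic.
-/
theorem jacketGenus_eq (J : Finset (Sym2 C)) :
    H.jacketGenus J = H.numComponents - ((Nat.card H.V : ℝ) - Nat.card H.Line) / 2
      - (H.pinchedFaces J : ℝ) / 2 := by
  rw [jacketGenus, pinchedEuler]; ring

theorem two_mul_degree [Fintype C] (hC : 3 ≤ Fintype.card C) :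
    2 * H.degree = (Fintype.card C - 1).factorial *
        (H.numComponents - ((Nat.card H.V : ℝ) - Nat.card H.Line) / 2)
      - (2 * ∑ J ∈ jackets C, (H.pinchedFaces J : ℝ)) / 2 := by
  rw [degree, Finset.sum_congr rfl fun J _ => jacketGenus_eq J, Finset.sum_sub_distrib,
    Finset.sum_const, nsmul_eq_mul, ← two_mul_card_jackets hC, ← Finset.sum_div]
  ring

/-- The faces of a closed jacket are indexed by its pairs, so the sum over jackets becomes a
weighted count of all faces. This is used for the melonic vertices and for the boundary graph. -/
theorem two_mul_degree_of_closed [Fintype C] [DecidableEq C] [Finite H.V] (hC : 3 ≤ Fintype.card C)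
    (hH : ∀ v c, ¬ H.IsExternal v c) :
    2 * H.degree = (Fintype.card C - 1).factorial *
        (H.numComponents - ((Nat.card H.V : ℝ) - Nat.card H.Line) / 2)
      - (Fintype.card C - 2).factorial * H.twiceFaces / 2 := by
  rw [two_mul_degree hC, twiceFaces]
  congr 2
  have := two_mul_sum_jackets_sum hC fun P => (Nat.card (H.Piece {c | c ∈ P}) : ℝ)
  simp only [setOf_mem_mk] at this
  rw [← this]
  congr 1
  refine Finset.sum_congr rfl fun J _ => ?_
  rw [pinchedFaces_of_closed hH]
  push_cast
  rfl

end ColoredGraph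

/-! ### Trace invariants and the number of faces of a melonic vertex. -/

namespace ClosedBipartite

variable {d : ℕ} (b : ClosedBipartite.{u} d)

theorem joined_edge (i : Fin d) (w : b.White) :
    b.toColored.Joined i (Sum.inl w) (Sum.inr (b.edge i w)) :=
  ⟨(w, i), rfl, Or.inl rfl, Or.inr rfl⟩

variable {b} in
theorem eq_of_joined {β : Type*} {i : Fin d} {u v : b.toColored.V} (h : b.toColored.Joined i u v)
    (f : b.White ⊕ b.Black → β) (hf : ∀ w, f (Sum.inl w) = f (Sum.inr (b.edge i w))) :
    f u = f v := by
  obtain ⟨⟨w, i⟩, rfl, hu, hv⟩ := h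
  have hw := hf w
  rcases hu with rfl | rfl <;> rcases hv with rfl | rfl
  exacts [rfl, hw, hw.symm, rfl]

theorem not_isExternal (v : b.toColored.V) (i : Fin d) : ¬ b.toColored.IsExternal v i := by
  intro h
  rcases v with w | y
  · exact h (w, i) rfl (Or.inl rfl)
  · exact h ((b.edge i).symm y, i) rfl (Or.inr (by simp))

instance finite_V : Finite b.toColored.V := inferInstanceAs (Finite (b.White ⊕ b.Black))

theorem card_V : Nat.card b.toColored.V = Nat.card b.White + Nat.card b.Black :=
  Nat.card_sum

theorem card_line : Nat.card b.toColored.Line = Nat.card b.White * d := by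
  change Nat.card (b.White × Fin d) = _
  simp

end ClosedBipartite

namespace TraceInvariant

variable {d : ℕ} (b : TraceInvariant.{u} d)

theorem numComponents_eq_one : b.toColored.numComponents = 1 := by
  have := b.connected.preconnected.subsingleton_connectedComponent
  have := b.connected.nonempty
  rw [ColoredGraph.numComponents, Nat.card_eq_one_iff_unique]
  exact ⟨inferInstance, inferInstance⟩

theorem valence_eq (i : Fin d) : b.valence = 2 * Nat.card b.White := by
  rw [valence, ← Nat.card_congr (b.edge i)]; ring

/-- The number of faces of a melonic trace invariant is fixed by its valence. -/
theorem IsMelonic.twiceFaces_eq {b : TraceInvariant.{u} d} (hd : 3 ≤ d) (hb : b.IsMelonic) :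
    b.toColored.twiceFaces =
      2 * ((d : ℝ) - 1) * (1 - (b.valence - (b.valence : ℝ) / 2 * d) / 2) := by
  have h := ColoredGraph.two_mul_degree_of_closed (H := b.toColored) (by simpa using hd)
    b.not_isExternal
  have hv := b.valence_eq ⟨0, by omega⟩
  have hV : Nat.card b.toColored.V = b.valence := b.card_V
  rw [show b.toColored.degree = 0 from hb, b.numComponents_eq_one, hV, b.card_line, hv,
    Fintype.card_fin] at h
  rw [hv]
  -- Since (d-1)! = (d-1)(d-2)!, the factor (d-2)! cancels.
  obtain ⟨n, rfl⟩ : ∃ n, d = n + 2 := ⟨d - 2, by omega⟩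
  rw [show n + 2 - 1 = n + 1 by omega, Nat.add_sub_cancel, Nat.factorial_succ] at h
  have hn : (n.factorial : ℝ) ≠ 0 := by exact_mod_cast n.factorial_ne_zero
  push_cast at h ⊢
  apply mul_left_cancel₀ hn
  linear_combination 2 * h

end TraceInvariant

/-! ### Strands of the colour extension and their ends. -/

namespace TensorGraph

open ColoredGraph

variable {d : ℕ} (G : TensorGraph.{u} d)

/-- The lines of colour `i` of the colour extension, other than the internal lines. -/
def edge (i : Fin d) : G.White ≃ G.Black :=
  Equiv.sigmaCongrRight fun v => (G.vertex v).edge i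

instance finite_V : Finite G.colorExt.V := inferInstanceAs (Finite (G.White ⊕ G.Black))

instance finite_boundary_V : Finite G.boundary.V :=
  inferInstanceAs (Finite {v : G.colorExt.V // G.colorExt.IsExternal v 0})

variable {G}

theorem joined_zero {w : G.White} {y : G.Black} (h : G.line w = some y) :
    G.colorExt.Joined 0 (Sum.inl w) (Sum.inr y) :=
  ⟨Sum.inl ⟨w, by rw [h]; rfl⟩, rfl, Or.inl rfl, Or.inr ⟨y, h, rfl⟩⟩

theorem joined_succ (i : Fin d) (w : G.White) :
    G.colorExt.Joined i.succ (Sum.inl w) (Sum.inr (G.edge i w)) :=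
  ⟨Sum.inr (w, i), rfl, Or.inl rfl, Or.inr rfl⟩

theorem eq_of_joined_zero {β : Type*} {u v : G.colorExt.V} (h : G.colorExt.Joined 0 u v)
    (f : G.White ⊕ G.Black → β) (hf : ∀ w y, G.line w = some y → f (Sum.inl w) = f (Sum.inr y)) :
    f u = f v := by
  obtain ⟨⟨w, hw⟩ | ⟨w, i⟩, hl, hu, hv⟩ := h
  · obtain ⟨y, hy⟩ := Option.isSome_iff_exists.1 hw
    have key : ∀ z : G.White ⊕ G.Black,
        (z = Sum.inl w ∨ ∃ y, G.line w = some y ∧ z = Sum.inr y) → f z = f (Sum.inl w) := by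
      rintro z (rfl | ⟨y, hy, rfl⟩)
      · rfl
      · exact (hf w y hy).symm
    exact (key u hu).trans (key v hv).symm
  · exact absurd hl (Fin.succ_ne_zero i)

theorem eq_of_joined_succ {β : Type*} {i : Fin d} {u v : G.colorExt.V}
    (h : G.colorExt.Joined i.succ u v)
    (f : G.White ⊕ G.Black → β) (hf : ∀ w, f (Sum.inl w) = f (Sum.inr (G.edge i w))) :
    f u = f v := by
  obtain ⟨⟨w, hw⟩ | ⟨w, j⟩, hl, hu, hv⟩ := h
  · exact absurd hl.symm (Fin.succ_ne_zero i)
  · obtain rfl : j = i := Fin.succ_injective _ hl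
    have key : ∀ z : G.White ⊕ G.Black,
        (z = Sum.inl w ∨ z = Sum.inr (G.edge j w)) → f z = f (Sum.inl w) := by
      rintro z (rfl | rfl)
      · rfl
      · exact (hf w).symm
    exact (key u hu).trans (key v hv).symm

theorem isExternal_inl {w : G.White} :
    G.colorExt.IsExternal (Sum.inl w) 0 ↔ G.line w = none := by
  constructor
  · intro h
    by_contra hw
    exact h (Sum.inl ⟨w, Option.isSome_iff_ne_none.2 hw⟩) rfl (Or.inl rfl)
  · rintro h (⟨w', hw'⟩ | ⟨w', i⟩) hl hv
    · rcases hv with hv | ⟨y, -, hv⟩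
      · obtain rfl := Sum.inl_injective hv
        rw [h] at hw'
        exact absurd hw' (by simp)
      · exact absurd hv (by simp)
    · exact absurd hl (Fin.succ_ne_zero i)

theorem isExternal_inr {y : G.Black} :
    G.colorExt.IsExternal (Sum.inr y) 0 ↔ G.line.symm y = none := by
  constructor
  · intro h
    by_contra hy
    obtain ⟨w, hw⟩ := Option.ne_none_iff_exists'.1 hy
    have hw' : G.line w = some y := (PEquiv.eq_some_iff _).1 hw
    exact h (Sum.inl ⟨w, by rw [hw']; rfl⟩) rfl (Or.inr ⟨y, hw', rfl⟩)
  · rintro h (⟨w', hw'⟩ | ⟨w', i⟩) hl hv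
    · rcases hv with hv | ⟨y', hy', hv⟩
      · exact absurd hv (by simp)
      · obtain rfl := Sum.inr_injective hv
        rw [(PEquiv.eq_some_iff _).2 hy'] at h
        exact absurd h (by simp)
    · exact absurd hl (Fin.succ_ne_zero i)

theorem not_isExternal_succ (v : G.colorExt.V) (i : Fin d) :
    ¬ G.colorExt.IsExternal v i.succ := by
  intro h
  rcases v with w | y
  · exact h (Sum.inr (w, i)) rfl (Or.inl rfl)
  · exact h (Sum.inr ((G.edge i).symm y, i)) rfl
      (Or.inr (congrArg Sum.inr ((G.edge i).apply_symm_apply y).symm))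

theorem pieceOpen_iff {i : Fin d} {f : G.StrandFace i} :
    G.colorExt.PieceOpen f ↔
      ∃ v, G.colorExt.pieceMk {0, i.succ} v = f ∧ G.colorExt.IsExternal v 0 := by
  constructor
  · rintro ⟨v, hv, c, rfl | rfl, h⟩
    · exact ⟨v, hv, h⟩
    · exact absurd h (not_isExternal_succ v i)
  · rintro ⟨v, hv, h⟩
    exact ⟨v, hv, 0, Or.inl rfl, h⟩

theorem pieceOpen_mk {i : Fin d} {v : G.colorExt.V} (h : G.colorExt.IsExternal v 0) :
    G.colorExt.PieceOpen (G.colorExt.pieceMk {0, i.succ} v) :=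
  pieceOpen_iff.2 ⟨v, rfl, h⟩

variable (G)

/-- An internal `(i j)` face avoiding the colour `0` is a face of one of the vertices. -/
theorem card_piece_succ_succ (i j : Fin d) :
    Nat.card (G.colorExt.Face i.succ j.succ) =
      ∑ᶠ v, Nat.card ((G.vertex v).toColored.Face i j) := by
  have := Fintype.ofFinite G.Vertex
  let φ : G.White ⊕ G.Black → Σ v, (G.vertex v).toColored.Face i j :=
    Sum.elim (fun w => ⟨w.1, (G.vertex w.1).toColored.pieceMk _ (Sum.inl w.2)⟩)
      (fun y => ⟨y.1, (G.vertex y.1).toColored.pieceMk _ (Sum.inr y.2)⟩)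
  let ψ (v : G.Vertex) : (G.vertex v).White ⊕ (G.vertex v).Black → G.White ⊕ G.Black :=
    Sum.map (fun w => ⟨v, w⟩) (fun y => ⟨v, y⟩)
  let e : G.colorExt.Face i.succ j.succ ≃ Σ v, (G.vertex v).toColored.Face i j :=
    { toFun := pieceLift φ (by
        rintro c (rfl | rfl) u v h
        · refine eq_of_joined_succ h φ fun w => ?_
          exact congrArg (Sigma.mk w.1) (pieceMk_eq (Set.mem_insert _ _)
            ((G.vertex w.1).joined_edge i w.2))
        · refine eq_of_joined_succ h φ fun w => ?_
          exact congrArg (Sigma.mk w.1) (pieceMk_eq (Set.mem_insert_of_mem _ (Set.mem_singleton _))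
            ((G.vertex w.1).joined_edge j w.2)))
      invFun := fun x => pieceLift (fun z => G.colorExt.pieceMk _ (ψ x.1 z)) (by
        rintro c (rfl | rfl) u v h
        · exact ClosedBipartite.eq_of_joined h (fun z => G.colorExt.pieceMk _ (ψ x.1 z)) fun w =>
            pieceMk_eq (Set.mem_insert _ _) (joined_succ c ⟨x.1, w⟩)
        · exact ClosedBipartite.eq_of_joined h (fun z => G.colorExt.pieceMk _ (ψ x.1 z)) fun w =>
            pieceMk_eq (Set.mem_insert_of_mem _ (Set.mem_singleton _)) (joined_succ c ⟨x.1, w⟩)) x.2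
      left_inv := by
        intro f
        obtain ⟨v, rfl⟩ := pieceMk_surjective _ f
        rcases v with w | y <;> rfl
      right_inv := by
        rintro ⟨v, f⟩
        obtain ⟨z, rfl⟩ := pieceMk_surjective _ f
        rcases z with w | y <;> rfl }
  rw [Nat.card_congr e, Nat.card_sigma, finsum_eq_sum_of_fintype]

variable {G}

/-- Along a face `(0 i)`, the half-lines reached from a white external leg form a chain, which does
not return to a white external leg. -/
theorem pieceMk_inl_injOn (i : Fin d) {w w' : G.White} (hw : G.line w = none)
    (hw' : G.line w' = none)
    (h : G.colorExt.pieceMk {0, i.succ} (Sum.inl w) = G.colorExt.pieceMk {0, i.succ} (Sum.inl w')) :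
    w = w' := by
  -- One step of the chain crosses the line of colour `i` to a black vertex and then the internal
  -- line there. Extended to black vertices along colour `i`, reachability from `w` is constant on
  -- the face.
  let R : G.White → Prop :=
    Relation.ReflTransGen (fun x x' => G.line.symm (G.edge i x) = some x') w
  let f : G.White ⊕ G.Black → Prop := Sum.elim R fun y => R ((G.edge i).symm y)
  have hf : ∀ c ∈ ({0, i.succ} : Set (Fin (d + 1))), ∀ u v : G.colorExt.V,
      G.colorExt.Joined c u v → f u = f v := by
    rintro c (rfl | rfl) u v h
    · refine eq_of_joined_zero h f fun x y hxy => propext ⟨fun hx => ?_, fun hx => ?_⟩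
      -- A chain ending at `x` is nonempty, because `w` carries no internal line while `x` does; its
      -- last step can be undone.
      · rcases Relation.ReflTransGen.cases_tail hx with rfl | ⟨x', hx', h'⟩
        · rw [hw] at hxy
          exact absurd hxy (by simp)
        · rw [← Option.mem_def, PEquiv.mem_iff_mem, Option.mem_def, hxy, Option.some_inj] at h'
          change R ((G.edge i).symm y)
          rw [h', Equiv.symm_apply_apply]
          exact hx'
      · refine Relation.ReflTransGen.tail hx ?_
        rw [Equiv.apply_symm_apply]
        exact (PEquiv.eq_some_iff _).2 hxy
    · exact eq_of_joined_succ h f fun x => by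
        change R x = R _
        rw [Equiv.symm_apply_apply]
  have hR : R w' := by
    have h1 := congrArg (pieceLift f hf) h
    exact (show f (Sum.inl w) = f (Sum.inl w') from h1).mp Relation.ReflTransGen.refl
  -- The end of a nonempty chain is entered through an internal line, which `w'` does not have.
  rcases Relation.ReflTransGen.cases_tail hR with h1 | ⟨x', -, h1⟩
  · exact h1.symm
  · rw [PEquiv.eq_some_iff, hw'] at h1
    exact absurd h1 (by simp)

/-- An open face has a white end. -/
theorem exists_inl_of_pieceOpen (i : Fin d) {f : G.StrandFace i} (hf : G.colorExt.PieceOpen f) :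
    ∃ w : G.White, G.line w = none ∧ G.colorExt.pieceMk {0, i.succ} (Sum.inl w) = f := by
  obtain ⟨v, hv, h⟩ := pieceOpen_iff.1 hf
  rcases v with w | y
  · exact ⟨w, isExternal_inl.1 h, hv⟩
  by_contra! hne
  rw [isExternal_inr] at h
  have hsome : ∀ x : {x : G.White // G.colorExt.pieceMk {0, i.succ} (Sum.inl x) = f},
      ∃ y, G.line x.1 = some y := fun x =>
    Option.ne_none_iff_exists'.1 fun hx => hne x.1 hx x.2
  choose p hp using hsome
  have hmem : ∀ y, G.colorExt.pieceMk {0, i.succ} (Sum.inl ((G.edge i).symm y)) =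
      G.colorExt.pieceMk {0, i.succ} (Sum.inr y) := fun y => by
    have := pieceMk_eq (H := G.colorExt) (S := {0, i.succ}) (Or.inr rfl)
      (joined_succ i ((G.edge i).symm y))
    rwa [Equiv.apply_symm_apply] at this
  -- If no white vertex of the face is a leg, following the internal line and then the line of
  -- colour `i` is an injective self-map of a finite set, hence surjective. Reaching the white
  -- vertex joined to `y` by colour `i` then forces an internal line at the leg `y`.
  let q : {x : G.White // G.colorExt.pieceMk {0, i.succ} (Sum.inl x) = f} →
      {x : G.White // G.colorExt.pieceMk {0, i.succ} (Sum.inl x) = f} := fun x =>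
    ⟨(G.edge i).symm (p x), by
      rw [hmem, ← x.2]
      exact (pieceMk_eq (H := G.colorExt) (S := {0, i.succ}) (Or.inl rfl)
        (joined_zero (hp x))).symm⟩
  have hq : Function.Injective q := by
    intro x x' hxx
    have h1 : p x = p x' := (G.edge i).symm.injective (Subtype.ext_iff.1 hxx)
    exact Subtype.ext (G.line.inj (hp x) (h1 ▸ hp x'))
  obtain ⟨x, hx⟩ := Finite.surjective_of_injective hq ⟨(G.edge i).symm y, by rw [hmem, hv]⟩
  have h1 : p x = y := (G.edge i).symm.injective (Subtype.ext_iff.1 hx)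
  have h2 := (PEquiv.eq_some_iff _).2 (hp x)
  rw [h1, h] at h2
  exact absurd h2 (by simp)

/-! ### Counts of half-lines and of lines of the boundary graph. -/

variable (G)

/-- Each open face `(0 i)` has exactly one white end. -/
theorem card_open_faces (i : Fin d) :
    Nat.card {f : G.StrandFace i // G.colorExt.PieceOpen f} =
      Nat.card {w : G.White // G.line w = none} := by
  symm
  refine Nat.card_congr (Equiv.ofBijective (fun w =>
    ⟨G.colorExt.pieceMk {0, i.succ} (Sum.inl w.1), pieceOpen_mk (isExternal_inl.2 w.2)⟩) ⟨?_, ?_⟩)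
  · intro w w' h
    exact Subtype.ext (pieceMk_inl_injOn i w.2 w'.2 (Subtype.ext_iff.1 h))
  · rintro ⟨f, hf⟩
    obtain ⟨w, hw, rfl⟩ := exists_inl_of_pieceOpen i hf
    exact ⟨⟨w, hw⟩, rfl⟩

theorem card_white_eq :
    Nat.card G.White = G.numLines + Nat.card {w : G.White // G.line w = none} := by
  classical
  rw [numLines, ← Nat.card_sum]
  refine Nat.card_congr ((Equiv.sumCompl fun w : G.White => (G.line w).isSome).symm.trans ?_)
  exact Equiv.sumCongr (Equiv.refl _) (Equiv.subtypeEquivRight fun w => by simp)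

theorem card_black_eq :
    Nat.card G.Black = G.numLines + Nat.card {y : G.Black // G.line.symm y = none} := by
  classical
  have e : G.Line ≃ {y : G.Black // (G.line.symm y).isSome} :=
    { toFun := fun w => ⟨(G.line w.1).get w.2, by
        rw [(PEquiv.eq_some_iff _).2 (Option.some_get w.2).symm]; rfl⟩
      invFun := fun y => ⟨(G.line.symm y.1).get y.2, by
        rw [(PEquiv.eq_some_iff _).1 (Option.some_get y.2).symm]; rfl⟩
      left_inv := fun w => by
        apply Subtype.ext
        apply Option.some_injective
        rw [Option.some_get]
        exact (PEquiv.eq_some_iff _).2 (Option.some_get w.2).symm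
      right_inv := fun y => by
        apply Subtype.ext
        apply Option.some_injective
        rw [Option.some_get]
        exact (PEquiv.eq_some_iff _).1 (Option.some_get y.2).symm }
  rw [numLines, Nat.card_congr e, ← Nat.card_sum]
  refine Nat.card_congr ((Equiv.sumCompl fun y : G.Black => (G.line.symm y).isSome).symm.trans ?_)
  exact Equiv.sumCongr (Equiv.refl _) (Equiv.subtypeEquivRight fun w => by simp)

theorem card_boundary_V : Nat.card G.boundary.V = G.numExt := by
  rw [numExt, ← Nat.card_sum]
  change Nat.card {v : G.White ⊕ G.Black // G.colorExt.IsExternal v 0} = _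
  refine Nat.card_congr (Equiv.subtypeSum.trans (Equiv.sumCongr ?_ ?_))
  · exact Equiv.subtypeEquivRight fun w => isExternal_inl
  · exact Equiv.subtypeEquivRight fun y => isExternal_inr

theorem card_boundary_line :
    Nat.card G.boundary.Line = d * Nat.card {w : G.White // G.line w = none} := by
  change Nat.card (Σ i : Fin d, {f : G.StrandFace i // G.colorExt.PieceOpen f}) = _
  rw [Nat.card_sigma, Finset.sum_congr rfl fun i _ => G.card_open_faces i]
  simp

theorem numInternalFaces_eq : G.numInternalFaces =
    ∑ i : Fin d, Nat.card {f : G.StrandFace i // ¬ G.colorExt.PieceOpen f} := by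
  rw [numInternalFaces, Nat.card_sigma]

theorem card_colorExt_V : Nat.card G.colorExt.V = Nat.card G.White + Nat.card G.Black :=
  Nat.card_sum

theorem card_colorExt_line : Nat.card G.colorExt.Line = G.numLines + Nat.card G.White * d := by
  change Nat.card (G.Line ⊕ (G.White × Fin d)) = _
  rw [Nat.card_sum, numLines, Nat.card_prod, Nat.card_fin]

theorem boundary_not_isExternal (v : G.boundary.V) (i : Fin d) : ¬ G.boundary.IsExternal v i :=
  fun h => h ⟨i, G.colorExt.pieceMk {0, i.succ} v.1, pieceOpen_mk v.2⟩ rfl rfl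

/-! ### Faces of a pinched jacket of the colour extension. -/

variable {G}

theorem boundary_joined_iff {i : Fin d} {u v : G.boundary.V} :
    G.boundary.Joined i u v ↔
      G.colorExt.pieceMk {0, i.succ} u.1 = G.colorExt.pieceMk {0, i.succ} v.1 := by
  constructor
  · rintro ⟨⟨i, f⟩, rfl, hu, hv⟩
    exact hu.trans hv.symm
  · intro h
    exact ⟨⟨i, G.colorExt.pieceMk {0, i.succ} v.1, pieceOpen_mk v.2⟩, rfl, h, rfl⟩

open Classical in
/-- A face `(0 k)` continued through the pinched legs: itself if it is internal, and otherwise the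
face of the boundary graph with colours in `S` that it belongs to. -/
noncomputable def strandEnd (S : Set (Fin d)) (k : Fin d) (f : G.StrandFace k) :
    {f : G.StrandFace k // ¬ G.colorExt.PieceOpen f} ⊕ G.boundary.Piece S :=
  if h : G.colorExt.PieceOpen f then
    Sum.inr (G.boundary.pieceMk S
      ⟨(pieceOpen_iff.1 h).choose, (pieceOpen_iff.1 h).choose_spec.2⟩)
  else Sum.inl ⟨f, h⟩

theorem strandEnd_of_not_open (S : Set (Fin d)) {k : Fin d} {f : G.StrandFace k}
    (h : ¬ G.colorExt.PieceOpen f) : strandEnd S k f = Sum.inl ⟨f, h⟩ :=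
  dif_neg h

/-- The leg chosen in `strandEnd` is immaterial when `k ∈ S`: legs on the same strand are ends of
one boundary line of colour `k`. -/
theorem strandEnd_of_isExternal {S : Set (Fin d)} {k : Fin d} (hk : k ∈ S) {v : G.colorExt.V}
    (h : G.colorExt.IsExternal v 0) :
    strandEnd S k (G.colorExt.pieceMk {0, k.succ} v) =
      Sum.inr (G.boundary.pieceMk S ⟨v, h⟩) := by
  have h1 := pieceOpen_mk (i := k) h
  rw [strandEnd, dif_pos h1]
  exact congrArg Sum.inr (pieceMk_eq hk (boundary_joined_iff.2 (pieceOpen_iff.1 h1).choose_spec.1))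

/-- The faces of a pinched jacket in which the neighbours of the colour `0` are `i` and `j`: those
which avoid the colour `0`, the internal faces `(0 i)` and `(0 j)`, and the faces `(i j)` of the
boundary graph. -/
theorem pinchedFaces_colorExt {J : Finset (Sym2 (Fin (d + 1)))} {i j : Fin d} (hij : i ≠ j)
    (hJ : ∀ P, P ∈ J ∧ 0 ∈ P ↔ P = s(0, i.succ) ∨ P = s(0, j.succ)) :
    G.colorExt.pinchedFaces J =
      ∑ P ∈ J with 0 ∉ P, Nat.card (G.colorExt.Piece {c | c ∈ P})
        + Nat.card {f : G.StrandFace i // ¬ G.colorExt.PieceOpen f}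
        + Nat.card {f : G.StrandFace j // ¬ G.colorExt.PieceOpen f}
        + Nat.card (G.boundary.Face i j) := by
  classical
  have hiJ := (hJ s(0, i.succ)).2 (Or.inl rfl)
  have hjJ := (hJ s(0, j.succ)).2 (Or.inr rfl)
  have hji : s(0, j.succ) ≠ s(0, i.succ) := by
    intro h
    have h1 := Sym2.congr_right.1 h
    exact hij (Fin.succ_injective _ h1).symm
  let S : Set (Fin d) := {i, j}
  let T := (Σ P : {P // P ∈ J.filter fun P => 0 ∉ P}, G.colorExt.Piece {c | c ∈ P.1}) ⊕
    (({f : G.StrandFace i // ¬ G.colorExt.PieceOpen f} ⊕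
      {f : G.StrandFace j // ¬ G.colorExt.PieceOpen f}) ⊕ G.boundary.Face i j)
  let F : G.colorExt.V × {P // P ∈ J} → T := fun x =>
    if h : 0 ∉ x.2.1 then
      Sum.inl ⟨⟨x.2.1, Finset.mem_filter.2 ⟨x.2.2, h⟩⟩, G.colorExt.pieceMk _ x.1⟩
    else Sum.inr (if x.2.1 = s(0, i.succ) then
        Sum.map Sum.inl id (strandEnd S i (G.colorExt.pieceMk {0, i.succ} x.1))
      else Sum.map Sum.inr id (strandEnd S j (G.colorExt.pieceMk {0, j.succ} x.1)))
  have F0 : ∀ v P (h : 0 ∉ P.1), F (v, P) =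
      Sum.inl ⟨⟨P.1, Finset.mem_filter.2 ⟨P.2, h⟩⟩, G.colorExt.pieceMk _ v⟩ :=
    fun v P h => dif_pos h
  have Fi : ∀ v h, F (v, ⟨s(0, i.succ), h⟩) = Sum.inr
      (Sum.map Sum.inl id (strandEnd S i (G.colorExt.pieceMk {0, i.succ} v))) := fun v h =>
    (dif_neg (by simp)).trans (congrArg Sum.inr (if_pos rfl))
  have Fj : ∀ v h, F (v, ⟨s(0, j.succ), h⟩) = Sum.inr
      (Sum.map Sum.inr id (strandEnd S j (G.colorExt.pieceMk {0, j.succ} v))) := fun v h =>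
    (dif_neg (by simp)).trans (congrArg Sum.inr (if_neg hji))
  -- At a leg the value does not depend on which of the two corners beside colour 0 is taken, so `F`
  -- is unchanged by turning around the inserted vertex.
  have hFr : ∀ P (hP : P ∈ J) (v : G.colorExt.V) (h : G.colorExt.IsExternal v 0), 0 ∈ P →
      F (v, ⟨P, hP⟩) = Sum.inr (Sum.inr (G.boundary.pieceMk S ⟨v, h⟩)) := by
    intro P hP v h h0
    rcases (hJ P).1 ⟨hP, h0⟩ with rfl | rfl
    · rw [Fi, strandEnd_of_isExternal (Or.inl rfl) h]; rfl
    · rw [Fj, strandEnd_of_isExternal (Or.inr rfl) h]; rfl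
  let F' : (G.colorExt.cornerGraph J).ConnectedComponent → T := SimpleGraph.fromRelLift F (by
    rintro ⟨u, ⟨P, hP⟩⟩ ⟨v, ⟨Q, hQ⟩⟩ (⟨h, c, hc, huv⟩ | ⟨h, c, hcP, hcQ, hv⟩)
    · obtain rfl : P = Q := Subtype.ext_iff.1 h
      by_cases h0 : 0 ∉ P
      · rw [F0 _ _ h0, F0 _ _ h0, pieceMk_eq (S := {c | c ∈ P}) hc huv]
      · rcases (hJ P).1 ⟨hP, not_not.1 h0⟩ with rfl | rfl
        · rw [Fi, Fi, pieceMk_eq (S := {0, i.succ}) (Sym2.mem_iff.1 hc) huv]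
        · rw [Fj, Fj, pieceMk_eq (S := {0, j.succ}) (Sym2.mem_iff.1 hc) huv]
    · obtain rfl : u = v := h
      rcases Fin.eq_zero_or_eq_succ c with rfl | ⟨k, rfl⟩
      · rw [hFr P hP u hv hcP, hFr Q hQ u hv hcQ]
      · exact absurd hv (not_isExternal_succ u k))
  have strand : ∀ (k : Fin d) (hk : s(0, k.succ) ∈ J) (u v : G.colorExt.V),
      G.colorExt.pieceMk {0, k.succ} u = G.colorExt.pieceMk {0, k.succ} v →
      G.colorExt.cornerMk J (u, ⟨_, hk⟩) = G.colorExt.cornerMk J (v, ⟨_, hk⟩) := fun k hk u v h =>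
    congrArg (pieceLift (fun v => G.colorExt.cornerMk J (v, ⟨_, hk⟩)) fun c hc u v h =>
      cornerMk_eq_of_joined ⟨_, hk⟩ (Sym2.mem_iff.2 hc) h) h
  have flip : ∀ v : G.colorExt.V, G.colorExt.IsExternal v 0 →
      G.colorExt.cornerMk J (v, ⟨_, hjJ.1⟩) = G.colorExt.cornerMk J (v, ⟨_, hiJ.1⟩) := fun v hv =>
    cornerMk_eq_of_isExternal _ _ hjJ.2 hiJ.2 hv
  let B : T → (G.colorExt.cornerGraph J).ConnectedComponent :=
    Sum.elim (fun x => pieceLift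
        (fun v => G.colorExt.cornerMk J (v, ⟨x.1.1, (Finset.mem_filter.1 x.1.2).1⟩))
        (fun c hc u v h => cornerMk_eq_of_joined _ hc h) x.2)
      (Sum.elim (Sum.elim
        (fun f => pieceLift (fun v => G.colorExt.cornerMk J (v, ⟨_, hiJ.1⟩))
          (fun c hc u v h => cornerMk_eq_of_joined ⟨_, hiJ.1⟩ (Sym2.mem_iff.2 hc) h) f.1)
        (fun f => pieceLift (fun v => G.colorExt.cornerMk J (v, ⟨_, hjJ.1⟩))
          (fun c hc u v h => cornerMk_eq_of_joined ⟨_, hjJ.1⟩ (Sym2.mem_iff.2 hc) h) f.1))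
        (pieceLift (fun v => G.colorExt.cornerMk J (v.1, ⟨_, hiJ.1⟩)) (by
          rintro c (rfl | rfl) u v h <;> rw [boundary_joined_iff] at h
          · exact strand _ _ _ _ h
          -- A boundary line of colour `j` runs along a strand (0 j): both ends are first moved to
          -- the corner {0, j} by turning around the pinched legs.
          · rw [← flip u.1 u.2, ← flip v.1 v.2]
            exact strand _ _ _ _ h)))
  have hFB : Function.LeftInverse F' B := by
    rintro (⟨⟨P, hP⟩, f⟩ | (⟨f, hf⟩ | ⟨f, hf⟩) | f)
    · obtain ⟨v, rfl⟩ := pieceMk_surjective _ f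
      exact F0 v ⟨P, (Finset.mem_filter.1 hP).1⟩ (Finset.mem_filter.1 hP).2
    · obtain ⟨v, rfl⟩ := pieceMk_surjective _ f
      refine (Fi v hiJ.1).trans ?_
      rw [strandEnd_of_not_open _ hf]; rfl
    · obtain ⟨v, rfl⟩ := pieceMk_surjective _ f
      refine (Fj v hjJ.1).trans ?_
      rw [strandEnd_of_not_open _ hf]; rfl
    · obtain ⟨v, rfl⟩ := pieceMk_surjective _ f
      exact hFr _ hiJ.1 v.1 v.2 hiJ.2
  -- A corner on an open strand can be slid along it to a leg, where it represents a boundary face.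
  have hB : Function.Surjective B := by
    intro x
    obtain ⟨⟨v, P, hP⟩, rfl⟩ := cornerMk_surjective J x
    by_cases h0 : 0 ∉ P
    · exact ⟨Sum.inl ⟨⟨P, Finset.mem_filter.2 ⟨hP, h0⟩⟩, G.colorExt.pieceMk _ v⟩, rfl⟩
    · rcases (hJ P).1 ⟨hP, not_not.1 h0⟩ with rfl | rfl
      · by_cases ho : G.colorExt.PieceOpen (G.colorExt.pieceMk {0, i.succ} v)
        · obtain ⟨u, hu, hext⟩ := pieceOpen_iff.1 ho
          exact ⟨Sum.inr (Sum.inr (G.boundary.pieceMk _ ⟨u, hext⟩)), strand i _ u v hu⟩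
        · exact ⟨Sum.inr (Sum.inl (Sum.inl ⟨_, ho⟩)), rfl⟩
      · by_cases ho : G.colorExt.PieceOpen (G.colorExt.pieceMk {0, j.succ} v)
        · obtain ⟨u, hu, hext⟩ := pieceOpen_iff.1 ho
          exact ⟨Sum.inr (Sum.inr (G.boundary.pieceMk _ ⟨u, hext⟩)),
            (flip u hext).symm.trans (strand j _ u v hu)⟩
        · exact ⟨Sum.inr (Sum.inl (Sum.inr ⟨_, ho⟩)), rfl⟩
  have h1 := Nat.card_congr (Equiv.ofBijective B ⟨hFB.injective, hB⟩)
  rw [pinchedFaces, ← h1, Nat.card_sum, Nat.card_sum, Nat.card_sum, Nat.card_sigma,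
    Finset.sum_coe_sort (J.filter fun P => 0 ∉ P)
      fun P => Nat.card (G.colorExt.Piece {c | c ∈ P})]
  ring

end TensorGraph

/-! ### Summation over jackets and elimination of the boundary faces. -/

namespace TensorGraph

open ColoredGraph

variable {d : ℕ} (G : TensorGraph.{u} d)

/-- Each vertex expands into a connected coloured graph, and the internal lines link these graphs as
they link the vertices of `G`. -/
theorem numComponents_colorExt (hG : G.Connected) : G.colorExt.numComponents = 1 := by
  let ψ (v : G.Vertex) : (G.vertex v).White ⊕ (G.vertex v).Black → G.White ⊕ G.Black :=
    Sum.map (fun w => ⟨v, w⟩) (fun y => ⟨v, y⟩)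
  have hψ : ∀ v z z', G.colorExt.pieceMk Set.univ (ψ v z) =
      G.colorExt.pieceMk Set.univ (ψ v z') := by
    intro v z z'
    have hs := (G.vertex v).connected.preconnected.subsingleton_connectedComponent
    have hz := hs.elim ((G.vertex v).toColored.pieceMk Set.univ z)
      ((G.vertex v).toColored.pieceMk Set.univ z')
    exact congrArg (pieceLift (fun z => G.colorExt.pieceMk Set.univ (ψ v z)) fun i _ u u' h =>
      ClosedBipartite.eq_of_joined h (fun z => G.colorExt.pieceMk Set.univ (ψ v z)) fun w =>
        pieceMk_eq (Set.mem_univ _) (joined_succ i ⟨v, w⟩)) hz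
  have hne : ∀ v, Nonempty ((G.vertex v).White ⊕ (G.vertex v).Black) := fun v =>
    (G.vertex v).connected.nonempty
  let g (v : G.Vertex) : G.colorExt.Piece Set.univ := G.colorExt.pieceMk Set.univ (ψ v (hne v).some)
  have hg : ∀ u v, g u = g v := by
    intro u v
    have hs := hG.preconnected.subsingleton_connectedComponent
    refine congrArg (SimpleGraph.fromRelLift g ?_)
      (hs.elim (SimpleGraph.connectedComponentMk _ u) (SimpleGraph.connectedComponentMk _ v))
    rintro u v ⟨x, y, h⟩
    exact (hψ u _ (Sum.inl x)).trans
      ((pieceMk_eq (Set.mem_univ _) (joined_zero h)).trans (hψ v (Sum.inr y) _))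
  have hall : ∀ z : G.colorExt.V, ∃ v, G.colorExt.pieceMk Set.univ z = g v := by
    rintro (w | y)
    · exact ⟨w.1, hψ w.1 (Sum.inl w.2) _⟩
    · exact ⟨y.1, hψ y.1 (Sum.inr y.2) _⟩
  rw [numComponents, Nat.card_eq_one_iff_unique]
  refine ⟨⟨fun f f' => ?_⟩, ⟨g hG.nonempty.some⟩⟩
  obtain ⟨z, rfl⟩ := pieceMk_surjective _ f
  obtain ⟨z', rfl⟩ := pieceMk_surjective _ f'
  obtain ⟨v, hv⟩ := hall z
  obtain ⟨v', hv'⟩ := hall z'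
  rw [hv, hv', hg v v']

theorem sum_card_piece_succ_succ [Fintype G.Vertex] :
    ∑ i : Fin d, ∑ j : Fin d,
        (if j = i then 0 else (Nat.card (G.colorExt.Face i.succ j.succ) : ℝ)) =
      ∑ v, (G.vertex v).toColored.twiceFaces := by
  simp only [twiceFaces]
  rw [Finset.sum_comm (s := (Finset.univ : Finset G.Vertex))]
  refine Finset.sum_congr rfl fun i _ => ?_
  rw [Finset.sum_comm]
  refine Finset.sum_congr rfl fun j _ => ?_
  split_ifs
  · simp
  · rw [card_piece_succ_succ, finsum_eq_sum_of_fintype]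
    push_cast
    rfl

/-- The degree of the colour extension in terms of the faces of the vertices, the internal faces and
the faces of the boundary graph. -/
theorem two_mul_degree_colorExt [Fintype G.Vertex] (hd : 2 ≤ d) (hG : G.Connected) :
    2 * G.colorExt.degree =
      d.factorial * (1 - ((Nat.card G.colorExt.V : ℝ) - Nat.card G.colorExt.Line) / 2)
      - ((d - 1).factorial * ∑ v, (G.vertex v).toColored.twiceFaces
        + 2 * ((d - 1).factorial * G.numInternalFaces)
        + (d - 2).factorial * G.boundary.twiceFaces) / 2 := by
  classical
  have hC : 3 ≤ Fintype.card (Fin (d + 1)) := by simpa using hd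
  have hcard : Fintype.card (Fin (d + 1)) = d + 1 := by simp
  -- The summands are the faces avoiding 0, the internal faces and the boundary faces, extended by
  -- zero to the colours where they have no meaning.
  let A : Sym2 (Fin (d + 1)) → ℝ := fun P =>
    if 0 ∉ P then (Nat.card (G.colorExt.Piece {c | c ∈ P}) : ℝ) else 0
  let F : Fin (d + 1) → ℝ :=
    Fin.cases 0 fun i => (Nat.card {f : G.StrandFace i // ¬ G.colorExt.PieceOpen f} : ℝ)
  let B : Fin (d + 1) → Fin (d + 1) → ℝ := fun x y =>
    Fin.cases 0 (fun i => Fin.cases 0 (fun j => (Nat.card (G.boundary.Face i j) : ℝ)) y) x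
  have key : ∀ σ ∈ fullCycles (Fin (d + 1)), (G.colorExt.pinchedFaces (neighbourPairs σ) : ℝ) =
      ∑ P ∈ neighbourPairs σ, A P + F (σ 0) + F (σ⁻¹ 0) + B (σ⁻¹ 0) (σ 0) := by
    intro σ hσ
    obtain ⟨j, hj⟩ := Fin.exists_succ_eq_of_ne_zero ((mem_fullCycles.1 hσ).2 0)
    obtain ⟨i, hi⟩ := Fin.exists_succ_eq_of_ne_zero
      ((mem_fullCycles.1 (inv_mem_fullCycles hσ)).2 0)
    have hij : i ≠ j := by
      rintro rfl
      refine apply_apply_ne hC hσ 0 ?_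
      rw [← hj, hi]
      simp
    have h1 := pinchedFaces_colorExt (G := G) (J := neighbourPairs σ) hij (by
      intro P
      constructor
      · rintro ⟨hP, h0⟩
        obtain ⟨c, rfl⟩ := Sym2.mem_iff_exists.1 h0
        rw [mk_mem_neighbourPairs] at hP
        rcases hP with rfl | rfl
        · rw [hj]; exact Or.inr rfl
        · rw [hi]; exact Or.inl rfl
      · rintro (rfl | rfl)
        · exact ⟨mk_mem_neighbourPairs.2 (Or.inr hi), by simp⟩
        · exact ⟨mk_mem_neighbourPairs.2 (Or.inl hj), by simp⟩)
    rw [h1, ← hi, ← hj]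
    simp only [A, F, B, Fin.cases_succ]
    push_cast
    rw [Finset.sum_filter]
    ring
  have hA : ∑ x, ∑ y, (if y = x then 0 else A s(x, y)) =
      ∑ v, (G.vertex v).toColored.twiceFaces := by
    rw [← sum_card_piece_succ_succ, Fin.sum_univ_succ]
    have h0 : ∑ y, (if y = 0 then 0 else A s(0, y)) = 0 :=
      Finset.sum_eq_zero fun y _ => by simp [A]
    rw [h0, zero_add]
    refine Finset.sum_congr rfl fun i _ => ?_
    rw [Fin.sum_univ_succ]
    have h0 : (if (0 : Fin (d + 1)) = i.succ then 0 else A s(i.succ, 0)) = 0 := by simp [A]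
    rw [h0, zero_add]
    refine Finset.sum_congr rfl fun j _ => ?_
    have h0 : (0 : Fin (d + 1)) ∉ s(i.succ, j.succ) := by
      simp [(Fin.succ_ne_zero _).symm]
    simp only [Fin.succ_inj, A, if_pos h0, setOf_mem_mk]
  have hF : ∑ y, (if y = 0 then 0 else F y) = G.numInternalFaces := by
    rw [Fin.sum_univ_succ, numInternalFaces_eq]
    simp [F]
  have hB : ∑ y, ∑ z, (if y = 0 ∨ z = 0 ∨ y = z then 0 else B y z) = G.boundary.twiceFaces := by
    rw [Fin.sum_univ_succ, twiceFaces]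
    simp only [true_or, if_true, Finset.sum_const_zero, zero_add]
    refine Finset.sum_congr rfl fun i _ => ?_
    rw [Fin.sum_univ_succ]
    simp [B, eq_comm]
  -- The internal faces enter twice, through the successor and through the predecessor of 0.
  rw [two_mul_degree hC, numComponents_colorExt G hG,
    two_mul_sum_jackets hC fun J => (G.colorExt.pinchedFaces J : ℝ), Finset.sum_congr rfl key,
    Finset.sum_add_distrib, Finset.sum_add_distrib, Finset.sum_add_distrib,
    ← two_mul_sum_jackets hC fun J => ∑ P ∈ J, A P, two_mul_sum_jackets_sum hC,
    sum_fullCycles_apply (by omega), sum_fullCycles_inv_apply (by omega),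
    sum_fullCycles_inv_apply_apply hC, hA, hF, hB, hcard]
  simp only [Nat.add_sub_cancel, show d + 1 - 2 = d - 1 by omega, show d + 1 - 3 = d - 2 by omega]
  push_cast
  ring

theorem sum_valences [Fintype G.Vertex] (f : ℕ → ℝ) :
    ∑ k ∈ G.valences, f k * (G.numVertices k : ℝ) = ∑ v, f (G.vertex v).valence := by
  classical
  rw [← Finset.sum_fiberwise_of_maps_to (s := Finset.univ) (t := G.valences)
    (g := fun v => (G.vertex v).valence) (fun v _ => by simp [valences])]
  refine Finset.sum_congr rfl fun k _ => ?_
  rw [Finset.sum_congr rfl (g := fun _ => f k) (fun v hv => by rw [(Finset.mem_filter.1 hv).2]),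
    Finset.sum_const, nsmul_eq_mul, numVertices, Nat.card_eq_fintype_card, Fintype.card_subtype,
    mul_comm]

theorem two_mul_card_white [Fintype G.Vertex] (i : Fin d) :
    2 * Nat.card G.White = ∑ v, (G.vertex v).valence := by
  rw [Nat.card_sigma, Finset.mul_sum]
  exact Finset.sum_congr rfl fun v _ => ((G.vertex v).valence_eq i).symm

/-- White and black half-lines are equally many, and each internal line uses one of either kind. -/
theorem numExt_eq (i : Fin d) : G.numExt = 2 * Nat.card {w : G.White // G.line w = none} := by
  have h1 := G.card_white_eq
  have h2 := G.card_black_eq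
  rw [Nat.card_congr (G.edge i)] at h1
  rw [numExt]
  omega

/-- The number of internal faces of a connected graph with melonic vertices. -/
theorem numInternalFaces_eq_degree [Fintype G.Vertex] (hd : 3 ≤ d) (hG : G.Connected)
    (hmel : ∀ v : G.Vertex, (G.vertex v).IsMelonic) :
    (G.numInternalFaces : ℝ) =
      - (2 / ((d - 1).factorial : ℝ)) * (G.colorExt.degree - G.boundary.degree)
        - ((G.boundary.numComponents : ℝ) - 1)
        + ((d : ℝ) - 1) * (1 - Fintype.card G.Vertex + G.numLines) := by
  have h1 := G.two_mul_degree_colorExt (by omega) hG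
  have h2 := two_mul_degree_of_closed (H := G.boundary) (by simpa using hd)
    G.boundary_not_isExternal
  -- Melonicity makes the faces of a vertex affine in its valence, so their total depends only on
  -- the numbers of vertices and of half-lines.
  have h3 : ∑ v, (G.vertex v).toColored.twiceFaces = 2 * ((d : ℝ) - 1) *
      (Fintype.card G.Vertex - Nat.card G.White * (1 - (d : ℝ) / 2)) := by
    have h4 : (2 : ℝ) * Nat.card G.White = ∑ v, ((G.vertex v).valence : ℝ) := by
      exact_mod_cast G.two_mul_card_white ⟨0, by omega⟩
    have h5 : ∀ v, (G.vertex v).toColored.twiceFaces = 2 * ((d : ℝ) - 1) +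
        (-2 * ((d : ℝ) - 1) * (1 - (d : ℝ) / 2) / 2) * (G.vertex v).valence := fun v => by
      rw [(hmel v).twiceFaces_eq hd]; ring
    rw [Finset.sum_congr rfl fun v _ => h5 v, Finset.sum_add_distrib, Finset.sum_const,
      ← Finset.mul_sum, ← h4, nsmul_eq_mul, Finset.card_univ]
    ring
  have hV := G.card_colorExt_V
  rw [← Nat.card_congr (G.edge ⟨0, by omega⟩)] at hV
  rw [h3, hV, card_colorExt_line, card_white_eq] at h1
  rw [card_boundary_V, card_boundary_line, numExt_eq _ ⟨0, by omega⟩, Fintype.card_fin] at h2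
  obtain ⟨n, rfl⟩ : ∃ n, d = n + 2 := ⟨d - 2, by omega⟩
  simp only [show n + 2 - 1 = n + 1 by omega, Nat.add_sub_cancel, Nat.factorial_succ] at h1 h2 ⊢
  have hn : (n.factorial : ℝ) ≠ 0 := by exact_mod_cast n.factorial_ne_zero
  have hn1 : (n : ℝ) + 1 ≠ 0 := by positivity
  push_cast at h1 h2 ⊢
  field_simp
  -- The boundary faces carry the same coefficient (d-2)!/2 in both formulas and cancel.
  linear_combination h1 - h2

end TensorGraph

theorem proposition2 (d : ℕ) (hd : 3 ≤ d) (B : BaseGroup) (D : ℕ) (hD : 1 ≤ D)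
    (a : ℝ) (ha0 : 0 < a) (ha1 : a ≤ 1)
    (G : TensorGraph.{u} d) (hG : G.Connected) (hmel : ∀ v : G.Vertex, (G.vertex v).IsMelonic) :
    G.divergenceDegree B D a =
      - (2 * (dimG B D : ℝ) / (Nat.factorial (d - 1) : ℝ))
          * (G.colorExt.degree - G.boundary.degree)
        - (dimG B D : ℝ) * ((G.boundary.numComponents : ℝ) - 1)
        - 1 / 2 * (((dimG B D : ℝ) * ((d : ℝ) - 1) - 2 * a) * (G.numExt : ℝ)
            - 2 * (dimG B D : ℝ) * ((d : ℝ) - 1))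
        - 1 / 2 * ∑ k ∈ G.valences,
            (2 * (dimG B D : ℝ) * ((d : ℝ) - 1)
              + (2 * a - (dimG B D : ℝ) * ((d : ℝ) - 1)) * (k : ℝ)) * (G.numVertices k : ℝ) := by
  have := Fintype.ofFinite G.Vertex
  have h1 : (2 : ℝ) * Nat.card G.White = ∑ v, ((G.vertex v).valence : ℝ) := by
    exact_mod_cast G.two_mul_card_white ⟨0, by omega⟩
  -- Both sides are reduced to internal lines, white legs and vertices, together with the degrees
  -- and the boundary components; the valences sum to twice the number of white half-lines.
  rw [TensorGraph.divergenceDegree, G.numInternalFaces_eq_degree hd hG hmel,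
    G.numExt_eq ⟨0, by omega⟩,
    G.sum_valences fun k => 2 * (dimG B D : ℝ) * ((d : ℝ) - 1)
      + (2 * a - (dimG B D : ℝ) * ((d : ℝ) - 1)) * (k : ℝ),
    Finset.sum_add_distrib, Finset.sum_const, ← Finset.mul_sum, ← h1, G.card_white_eq,
    nsmul_eq_mul, Finset.card_univ]
  push_cast
  ring
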